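/- For $q\in\mathbb{C}$ with $|q|<1$ and $s\in\mathbb{C}$ let $$\mathcal{L}_q(s)=\sum_{n=1}^{\infty}\frac{n^{s}q^{n}}{1-q^{n}}$$ be the Lambert series. Let $B_n$ denote the Bernoulli numbers, $\zeta$ the Riemann zeta function and $\delta_{jk}$ the Kronecker delta. Then for every integer $k\ge 1$ the three Lambert series below converge absolutely and $$ \begin{aligned} \zeta(4k-1)=\,&(2\pi)^{4k-1}\sum_{j=0}^{k}\frac{(-1)^{j+1}\,b_{jk}\,B_{2j}\,B_{4k-2j}}{(2j)!\,(4k-2j)!} +\frac{2^{4k+1}+4}{a_k}\,\mathcal{L}_{e^{-\sqrt{3}\pi}}(-4k+1)\\ &-\frac{2^{4k+2}+2^{-4k+4}+12+8\cos\big[\tfrac{(2k-1)\pi}{3}\big]}{a_k}\,\mathcal{L}_{e^{-2\sqrt{3}\pi}}(-4k+1) +\frac{2^{-4k+4}+8}{a_k}\,\mathcal{L}_{e^{-4\sqrt{3}\pi}}(-4k+1), \end{aligned} $$ where $$ a_k=2^{4k}+4\sin\big[\tfrac{(4k+1)\pi}{6}\big],\qquad b_{jk}=\frac{2^{4k+1-2j}\cos\big[\tfrac{(2j-1)\pi}{6}\big]+2^{2j+1}\cos\big[\tfrac{(4k-1-2j)\pi}{6}\big]}{a_k\,(1+\delta_{jk})}.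 $$ -/

import Mathlib

/-- The `n`-th term (`n = 0, 1, 2, …`, indexing the positive integer `n + 1`) of the Lambert series
`∑_{m ≥ 1} m ^ s q ^ m / (1 - q ^ m)`. -/
noncomputable def lambertTerm (q s : ℂ) (n : ℕ) : ℂ :=
  ((n + 1 : ℕ) : ℂ) ^ s * q ^ (n + 1) / (1 - q ^ (n + 1))

/-- The Lambert series `L_q(s) = ∑_{m ≥ 1} m ^ s q ^ m / (1 - q ^ m)`, for `|q| < 1`. -/
noncomputable def lambertSeries (q s : ℂ) : ℂ :=
  ∑' n : ℕ, lambertTerm q s n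

/-- `a_k = 2 ^ (4k) + 4 sin ((4k + 1) π / 6)`. -/
noncomputable def coeffA (k : ℕ) : ℝ :=
  2 ^ (4 * k) + 4 * Real.sin ((4 * (k : ℝ) + 1) * Real.pi / 6)

/-- `b_{jk} = (2 ^ (4k + 1 - 2j) cos ((2j - 1) π / 6) + 2 ^ (2j + 1) cos ((4k - 1 - 2j) π / 6))
/ (a_k (1 + δ_{jk}))`. -/
noncomputable def coeffB (j k : ℕ) : ℝ :=
  ((2 : ℝ) ^ (4 * (k : ℤ) + 1 - 2 * (j : ℤ)) * Real.cos ((2 * (j : ℝ) - 1) * Real.pi / 6)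
      + (2 : ℝ) ^ (2 * (j : ℤ) + 1)
        * Real.cos ((4 * (k : ℝ) - 1 - 2 * (j : ℝ)) * Real.pi / 6))
    / (coeffA k * (1 + if j = k then 1 else 0))

/-- The Bernoulli-number part
`(2π) ^ (4k - 1) ∑_{j = 0}^k (-1) ^ (j + 1) b_{jk} B_{2j} B_{4k - 2j} / ((2j)! (4k - 2j)!)`,
for `k ≥ 1`. -/
noncomputable def bernoulliPart (k : ℕ) : ℝ :=
  (2 * Real.pi) ^ (4 * k - 1) *
    ∑ j ∈ Finset.range (k + 1),
      (-1) ^ (j + 1) * coeffB j k * (bernoulli (2 * j) : ℝ) * (bernoulli (4 * k - 2 * j) : ℝ)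
        / (((2 * j).factorial : ℝ) * ((4 * k - 2 * j).factorial : ℝ))

/-- The nome `e ^ (-m √3 π)`. -/
noncomputable def nome (m : ℕ) : ℂ :=
  ((Real.exp (-((m : ℝ) * Real.sqrt 3 * Real.pi)) : ℝ) : ℂ)

/-! With M = 4k-1, the formula is Ramanujan's transformation `ramanujan_lambertSeries` under τ ↦
-1/τ, added over τ = (±1 + i√3)/4. Both images ∓1 + i√3 have nome e^(-2√3π), while the points
themselves have nomes r and -r, where r² = -e^(-√3π). As τ is half a sixth root of unity up to sign,
the sums of powers of τ collapse to cosines and sines, and folding the Bernoulli sum under j ↔ 2k-j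
gives b_{jk}. Splitting a Lambert series by parity (`lambertSeries_add_neg`) rewrites L_r + L_{-r}
through -e^(-√3π) and e^(-2√3π); a second use removes the negative nome at the cost of e^(-4√3π).
Solving for ζ(4k-1) makes a_k the denominator.

Ramanujan's formula itself comes from evaluating ∑ π cot(πnτ)/n^(2N+1) twice: the exponential form
of cot gives a Lambert series, its partial fractions a double series whose summation indices are
exchanged by τ ↦ -1/τ. -/

/-! ### Lambert series at negative integers and their parity relation -/

/-- The terms of the Lambert series at a negative integer exponent. -/
theorem lambertTerm_neg_natCast (q : ℂ) (M n : ℕ) :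
    lambertTerm q (-(M : ℂ)) n = q ^ (n + 1) / (((n : ℂ) + 1) ^ M * (1 - q ^ (n + 1))) := by
  rw [lambertTerm, Complex.cpow_neg, Complex.cpow_natCast, inv_mul_eq_div, div_div]
  push_cast
  rfl

theorem norm_pow_succ_lt_one {q : ℂ} (hq : ‖q‖ < 1) (n : ℕ) : ‖q ^ (n + 1)‖ < 1 := by
  rw [norm_pow]
  exact pow_lt_one₀ (norm_nonneg _) hq (Nat.succ_ne_zero n)

theorem one_sub_ne_zero_of_norm_lt_one {q : ℂ} (hq : ‖q‖ < 1) : 1 - q ≠ 0 := by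
  intro h
  rw [← sub_eq_zero.mp h] at hq
  simp at hq

theorem summable_lambertTerm {q : ℂ} (hq : ‖q‖ < 1) (M : ℕ) :
    Summable (lambertTerm q (-(M : ℂ))) := by
  have hg : Summable fun n : ℕ => ‖q‖ ^ n * (1 - ‖q‖)⁻¹ :=
    (summable_geometric_of_lt_one (norm_nonneg _) hq).mul_right _
  refine Summable.of_norm_bounded hg fun n => ?_
  have h1 : (1 : ℝ) ≤ ‖((n : ℂ) + 1) ^ M‖ := by
    rw [norm_pow]
    refine one_le_pow₀ ?_
    rw [← Nat.cast_succ, Complex.norm_natCast]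
    exact_mod_cast Nat.succ_pos n
  have h2 : 1 - ‖q‖ ≤ ‖1 - q ^ (n + 1)‖ := by
    refine le_trans ?_ (norm_sub_norm_le _ _)
    rw [norm_one, norm_pow]
    have := pow_le_of_le_one (norm_nonneg q) hq.le (Nat.succ_ne_zero n)
    simp only [Nat.succ_eq_add_one] at this
    linarith
  have h3 : 0 < 1 - ‖q‖ := by linarith
  rw [lambertTerm_neg_natCast, norm_div, norm_mul, div_eq_mul_inv]
  gcongr ?_ * ?_⁻¹
  · rw [norm_pow]
    exact pow_le_pow_of_le_one (norm_nonneg _) hq.le (Nat.le_succ n)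
  · nlinarith

theorem tsum_even_add_tsum_odd {f : ℕ → ℂ} (hf : Summable f) :
    ∑' n, f (2 * n) + ∑' n, f (2 * n + 1) = ∑' n, f n :=
  tsum_even_add_odd (hf.comp_injective (i := fun n => 2 * n) fun a b h => by dsimp only at h; omega)
    (hf.comp_injective (i := fun n => 2 * n + 1) fun a b h => by dsimp only at h; omega)

/-- Index `2 * n` stands for the odd integer 2n+1, where the identity is x/(1-x) - x/(1+x) =
2x²/(1-x²) with x = r^(2n+1). -/
theorem lambertTerm_add_neg_even {r : ℂ} (hr : ‖r‖ < 1) (M n : ℕ) :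
    lambertTerm r (-(M : ℂ)) (2 * n) + lambertTerm (-r) (-(M : ℂ)) (2 * n)
      - 2 * lambertTerm (r ^ 2) (-(M : ℂ)) (2 * n) = 0 := by
  have hneg : ‖-r‖ < 1 := by rwa [norm_neg]
  have h2 : ‖r ^ 2‖ < 1 := norm_pow_succ_lt_one hr 1
  have e1 : (-r) ^ (2 * n + 1) = -r ^ (2 * n + 1) := Odd.neg_pow ⟨n, rfl⟩ r
  have e2 : (r ^ 2) ^ (2 * n + 1) = (r ^ (2 * n + 1)) ^ 2 := by ring
  have n1 : 1 - r ^ (2 * n + 1) ≠ 0 :=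
    one_sub_ne_zero_of_norm_lt_one (norm_pow_succ_lt_one hr _)
  have n2 : 1 - (-r) ^ (2 * n + 1) ≠ 0 :=
    one_sub_ne_zero_of_norm_lt_one (norm_pow_succ_lt_one hneg _)
  have n3 : 1 - (r ^ 2) ^ (2 * n + 1) ≠ 0 :=
    one_sub_ne_zero_of_norm_lt_one (norm_pow_succ_lt_one h2 _)
  have n0 : (((2 * n : ℕ) : ℂ) + 1) ^ M ≠ 0 := pow_ne_zero _ (Nat.cast_add_one_ne_zero _)
  simp only [lambertTerm_neg_natCast]
  rw [e1] at n2 ⊢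
  rw [e2] at n3 ⊢
  generalize (((2 * n : ℕ) : ℂ) + 1) ^ M = c at *
  generalize r ^ (2 * n + 1) = x at *
  field_simp
  ring

/-- At the even integer 2(n+1) the signs of ±r disappear, and each term is 2^(-M) times the term at
n+1 for the squared nome. -/
theorem lambertTerm_add_neg_odd (r : ℂ) (M n : ℕ) :
    lambertTerm r (-(M : ℂ)) (2 * n + 1) + lambertTerm (-r) (-(M : ℂ)) (2 * n + 1)
        - 2 * lambertTerm (r ^ 2) (-(M : ℂ)) (2 * n + 1) =
      2 / 2 ^ M * (lambertTerm (r ^ 2) (-(M : ℂ)) n - lambertTerm (r ^ 4) (-(M : ℂ)) n) := by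
  have e0 : (((2 * n + 1 : ℕ) : ℂ) + 1) ^ M = 2 ^ M * ((n : ℂ) + 1) ^ M := by
    rw [← mul_pow]
    congr 1
    push_cast
    ring
  have e1 : (-r) ^ (2 * n + 1 + 1) = (r ^ 2) ^ (n + 1) := by
    rw [← neg_sq r, ← pow_mul]
    rfl
  have e2 : r ^ (2 * n + 1 + 1) = (r ^ 2) ^ (n + 1) := by
    rw [← pow_mul]
    rfl
  have e3 : (r ^ 2) ^ (2 * n + 1 + 1) = (r ^ 4) ^ (n + 1) := by
    rw [← pow_mul, ← pow_mul]
    congr 1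
    ring
  simp only [lambertTerm_neg_natCast, e0, e1, e2, e3, mul_assoc, ← div_div _ ((2 : ℂ) ^ M)]
  ring

/-- The relation between the Lambert series at `±r`, `r ^ 2` and `r ^ 4`. -/
theorem lambertSeries_add_neg {r : ℂ} (hr : ‖r‖ < 1) (M : ℕ) :
    lambertSeries r (-(M : ℂ)) + lambertSeries (-r) (-(M : ℂ)) =
      (2 + 2 / 2 ^ M) * lambertSeries (r ^ 2) (-(M : ℂ))
        - 2 / 2 ^ M * lambertSeries (r ^ 4) (-(M : ℂ)) := by
  have s1 := summable_lambertTerm hr M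
  have s1' := summable_lambertTerm (q := -r) (by rwa [norm_neg]) M
  have s2 := summable_lambertTerm (norm_pow_succ_lt_one hr 1) M
  have s4 := summable_lambertTerm (norm_pow_succ_lt_one hr 3) M
  have key := tsum_even_add_tsum_odd ((s1.add s1').sub (s2.mul_left 2))
  simp only [Nat.reduceAdd] at s2 s4 key
  simp only [lambertTerm_add_neg_even hr, lambertTerm_add_neg_odd, tsum_zero, zero_add] at key
  rw [(s1.add s1').tsum_sub (s2.mul_left 2), s1.tsum_add s1', tsum_mul_left, tsum_mul_left,
    s2.tsum_sub s4] at key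
  simp only [lambertSeries]
  linear_combination -key

/-! ### The double series and the exchange of its indices -/

/-- The double series obtained from the partial fraction expansion of the cotangent. -/
noncomputable def cotDoubleTerm (N : ℕ) (τ : ℂ) (p : ℕ × ℕ) : ℂ :=
  1 / (((p.1 : ℂ) + 1) ^ (2 * N) * (((p.1 : ℂ) + 1) ^ 2 * τ ^ 2 - ((p.2 : ℂ) + 1) ^ 2))

/-- The double series `cotDoubleTerm` with the two indices exchanged in the outer factor. -/
noncomputable def cotDoubleTermSwap (N : ℕ) (τ : ℂ) (p : ℕ × ℕ) : ℂ :=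
  1 / (((p.2 : ℂ) + 1) ^ (2 * N) * (((p.1 : ℂ) + 1) ^ 2 * τ ^ 2 - ((p.2 : ℂ) + 1) ^ 2))

/-- The difference of squares factors as (aτ + b)(aτ - b) with a = n+1, b = m+1, and each factor has
norm at least `EisensteinSeries.r τ` times max(a, b). -/
theorem norm_sq_mul_sq_sub_sq_ge (τ : UpperHalfPlane) (n m : ℕ) :
    EisensteinSeries.r τ ^ 2 * ((n : ℝ) + 1) ^ 2 ≤
        ‖((n : ℂ) + 1) ^ 2 * (τ : ℂ) ^ 2 - ((m : ℂ) + 1) ^ 2‖ ∧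
      EisensteinSeries.r τ ^ 2 * ((m : ℝ) + 1) ^ 2 ≤
        ‖((n : ℂ) + 1) ^ 2 * (τ : ℂ) ^ 2 - ((m : ℂ) + 1) ^ 2‖ := by
  have hr := (EisensteinSeries.r_pos τ).le
  have hz : ∀ b : ℤ, (![(n : ℤ) + 1, b] : Fin 2 → ℤ) ≠ 0 := fun b h => by
    have := congrFun h 0
    simp at this
    omega
  have b1 := EisensteinSeries.r_mul_max_le τ (hz ((m : ℤ) + 1))
  have b2 := EisensteinSeries.r_mul_max_le τ (hz (-((m : ℤ) + 1)))
  have l1 := EisensteinSeries.abs_le_left_of_norm ((m : ℤ) + 1) ((n : ℤ) + 1)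
  have l2 := EisensteinSeries.abs_le_left_of_norm (-((m : ℤ) + 1)) ((n : ℤ) + 1)
  have l3 := EisensteinSeries.abs_le_right_of_norm ((m : ℤ) + 1) ((n : ℤ) + 1)
  have l4 := EisensteinSeries.abs_le_right_of_norm (-((m : ℤ) + 1)) ((n : ℤ) + 1)
  rw [abs_neg] at l4
  rw [abs_of_nonneg (by positivity)] at l1 l2 l3 l4
  push_cast at l1 l2 l3 l4
  simp only [Matrix.cons_val_zero, Matrix.cons_val_one] at b1 b2
  push_cast at b1 b2
  have e : ((n : ℂ) + 1) ^ 2 * (τ : ℂ) ^ 2 - ((m : ℂ) + 1) ^ 2 =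
      (((n : ℂ) + 1) * τ + ((m : ℂ) + 1)) * (((n : ℂ) + 1) * τ + (-1 + -(m : ℂ))) := by ring
  have e' : (-1 + -(m : ℂ)) = -((m : ℂ) + 1) := by ring
  rw [e, norm_mul, e']
  constructor
  · calc _ = (EisensteinSeries.r τ * ((n : ℝ) + 1)) * (EisensteinSeries.r τ * ((n : ℝ) + 1)) := by
          ring
      _ ≤ _ := by
          gcongr
          · exact (mul_le_mul_of_nonneg_left l1 hr).trans b1
          · exact (mul_le_mul_of_nonneg_left l2 hr).trans b2
  · calc _ = (EisensteinSeries.r τ * ((m : ℝ) + 1)) * (EisensteinSeries.r τ * ((m : ℝ) + 1)) := by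
          ring
      _ ≤ _ := by
          gcongr
          · exact (mul_le_mul_of_nonneg_left l3 hr).trans b1
          · exact (mul_le_mul_of_nonneg_left l4 hr).trans b2

theorem sq_mul_sq_sub_sq_ne_zero (τ : UpperHalfPlane) (n m : ℕ) :
    ((n : ℂ) + 1) ^ 2 * (τ : ℂ) ^ 2 - ((m : ℂ) + 1) ^ 2 ≠ 0 := by
  have hr := EisensteinSeries.r_pos τ
  rw [← norm_pos_iff]
  exact lt_of_lt_of_le (by positivity) (norm_sq_mul_sq_sub_sq_ge τ n m).1

theorem norm_natCast_add_one (n : ℕ) : ‖(n : ℂ) + 1‖ = (n : ℝ) + 1 := by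
  rw [← Nat.cast_succ, Complex.norm_natCast, Nat.cast_succ]

theorem summable_one_div_succ_pow {a : ℕ} (ha : 2 ≤ a) :
    Summable fun n : ℕ => 1 / ((n : ℂ) + 1) ^ a := by
  have h : Summable fun n : ℕ => 1 / (n : ℝ) ^ a := Real.summable_one_div_nat_pow.mpr ha
  refine Summable.of_norm (((summable_nat_add_iff 1).mpr h).congr fun n => ?_)
  rw [norm_div, norm_one, norm_pow, norm_natCast_add_one, Nat.cast_add_one]

theorem summable_inv_sq_mul_inv_sq (c : ℝ) :
    Summable fun p : ℕ × ℕ => c * (1 / ((p.1 : ℝ) + 1) ^ 2 * (1 / ((p.2 : ℝ) + 1) ^ 2)) := by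
  have h : Summable fun n : ℕ => 1 / ((n : ℝ) + 1) ^ 2 := by
    have h := (summable_nat_add_iff 1).mpr (Real.summable_one_div_nat_pow.mpr one_lt_two)
    simpa using h
  exact (h.mul_of_nonneg h (fun n => by positivity) (fun n => by positivity)).mul_left c

theorem norm_one_div_mul_le {A B : ℂ} {c x y : ℝ} (hc : 0 < c) (hx : 0 < x) (hy : 0 < y)
    (hA : x ≤ ‖A‖) (hB : c * y ≤ ‖B‖) : ‖1 / (A * B)‖ ≤ 1 / c * (1 / x * (1 / y)) := by
  rw [norm_div, norm_mul, norm_one]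
  calc 1 / (‖A‖ * ‖B‖) ≤ 1 / (x * (c * y)) := by gcongr
    _ = 1 / c * (1 / x * (1 / y)) := by field_simp

theorem succ_sq_le_norm_pow {N : ℕ} (hN : 1 ≤ N) (n : ℕ) :
    ((n : ℝ) + 1) ^ 2 ≤ ‖((n : ℂ) + 1) ^ (2 * N)‖ := by
  rw [norm_pow, norm_natCast_add_one]
  exact pow_le_pow_right₀ (by linarith [(Nat.cast_nonneg n : (0 : ℝ) ≤ n)]) (by omega)

theorem summable_cotDoubleTerm (τ : UpperHalfPlane) {N : ℕ} (hN : 1 ≤ N) :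
    Summable (cotDoubleTerm N τ) := by
  have hr := EisensteinSeries.r_pos τ
  refine Summable.of_norm_bounded
    (summable_inv_sq_mul_inv_sq (1 / EisensteinSeries.r τ ^ 2)) fun p => ?_
  exact norm_one_div_mul_le (by positivity) (by positivity) (by positivity)
    (succ_sq_le_norm_pow hN p.1) (norm_sq_mul_sq_sub_sq_ge τ p.1 p.2).2

theorem summable_cotDoubleTermSwap (τ : UpperHalfPlane) {N : ℕ} (hN : 1 ≤ N) :
    Summable (cotDoubleTermSwap N τ) := by
  have hr := EisensteinSeries.r_pos τ
  refine Summable.of_norm_bounded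
    (summable_inv_sq_mul_inv_sq (1 / EisensteinSeries.r τ ^ 2)) fun p => ?_
  rw [mul_comm (1 / ((p.1 : ℝ) + 1) ^ 2)]
  exact norm_one_div_mul_le (by positivity) (by positivity) (by positivity)
    (succ_sq_le_norm_pow hN p.2) (norm_sq_mul_sq_sub_sq_ge τ p.1 p.2).1

theorem riemannZeta_eq_tsum_succ {a : ℕ} (ha : 2 ≤ a) :
    riemannZeta a = ∑' n : ℕ, 1 / ((n : ℂ) + 1) ^ a := by
  rw [zeta_eq_tsum_one_div_nat_add_one_cpow (by rw [Complex.natCast_re]; exact_mod_cast ha)]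
  simp

theorem hasSum_one_div_mul_one_div {a b : ℕ} (ha : 2 ≤ a) (hb : 2 ≤ b) :
    HasSum (fun p : ℕ × ℕ => 1 / ((p.1 : ℂ) + 1) ^ a * (1 / ((p.2 : ℂ) + 1) ^ b))
      (riemannZeta a * riemannZeta b) := by
  have h := summable_one_div_succ_pow ha
  have h' := summable_one_div_succ_pow hb
  have hs := summable_mul_of_summable_norm h.norm h'.norm
  rw [riemannZeta_eq_tsum_succ ha, riemannZeta_eq_tsum_succ hb, h.tsum_mul_tsum h' hs]
  exact hs.hasSum

/-- With x = (p.1+1)², y = (p.2+1)², t = τ², this is the geometric sum factorisation of (xt)^N - y^N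
divided by x^N y^N (xt - y). -/
theorem cotDoubleTerm_eq (τ : UpperHalfPlane) (N : ℕ) (p : ℕ × ℕ) :
    cotDoubleTerm N τ p = (τ : ℂ) ^ (2 * N) * cotDoubleTermSwap N τ p
      - ∑ i ∈ Finset.range N, (τ : ℂ) ^ (2 * i) *
        (1 / ((p.1 : ℂ) + 1) ^ (2 * (N - i)) * (1 / ((p.2 : ℂ) + 1) ^ (2 * (i + 1)))) := by
  have h0 := sq_mul_sq_sub_sq_ne_zero τ p.1 p.2
  have h1 : ((p.1 : ℂ) + 1) ^ 2 ≠ 0 := pow_ne_zero _ (Nat.cast_add_one_ne_zero _)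
  have h2 : ((p.2 : ℂ) + 1) ^ 2 ≠ 0 := pow_ne_zero _ (Nat.cast_add_one_ne_zero _)
  simp only [cotDoubleTerm, cotDoubleTermSwap, pow_mul]
  generalize ((p.1 : ℂ) + 1) ^ 2 = x at *
  generalize ((p.2 : ℂ) + 1) ^ 2 = y at *
  generalize (τ : ℂ) ^ 2 = t at *
  have hg := (Commute.all (x * t) y).geom_sum₂_mul N
  have hS : ∑ i ∈ Finset.range N, t ^ i * (1 / x ^ (N - i) * (1 / y ^ (i + 1))) =
      (∑ i ∈ Finset.range N, (x * t) ^ i * y ^ (N - 1 - i)) / (x ^ N * y ^ N) := by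
    rw [Finset.sum_div]
    refine Finset.sum_congr rfl fun i hi => ?_
    have hi' := Finset.mem_range.mp hi
    obtain ⟨d, rfl⟩ : ∃ d, N = i + d + 1 := ⟨N - i - 1, by omega⟩
    rw [show i + d + 1 - i = d + 1 by omega, show i + d + 1 - 1 - i = d by omega]
    field_simp
    ring
  rw [hS, ← eq_div_iff h0] at *
  rw [hg, mul_pow]
  field_simp
  ring

/-- Exchanging the roles of the two indices of the double series costs a finite sum of products of
zeta values. -/
theorem tsum_cotDoubleTerm_eq (τ : UpperHalfPlane) {N : ℕ} (hN : 1 ≤ N) :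
    ∑' p, cotDoubleTerm N τ p = (τ : ℂ) ^ (2 * N) * ∑' p, cotDoubleTermSwap N τ p
      - ∑ i ∈ Finset.range N, (τ : ℂ) ^ (2 * i) *
        (riemannZeta (2 * (N - i) : ℕ) * riemannZeta (2 * (i + 1) : ℕ)) := by
  simp only [cotDoubleTerm_eq τ N]
  refine HasSum.tsum_eq (((summable_cotDoubleTermSwap τ hN).hasSum.mul_left _).sub
    (hasSum_sum fun i hi => HasSum.mul_left _ ?_))
  have hi' := Finset.mem_range.mp hi
  exact hasSum_one_div_mul_one_div (by omega) (by omega)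

theorem tsum_cotDoubleTerm_neg_inv {τ τ' : ℂ} (hτ : τ ≠ 0) (h : τ' = -1 / τ) (N : ℕ) :
    ∑' p, cotDoubleTerm N τ' p = -τ ^ 2 * ∑' p, cotDoubleTermSwap N τ p := by
  rw [← (Equiv.prodComm ℕ ℕ).tsum_eq (cotDoubleTerm N τ'), ← tsum_mul_left]
  refine tsum_congr fun p => ?_
  simp only [cotDoubleTerm, cotDoubleTermSwap, Equiv.prodComm_apply, Prod.fst_swap, Prod.snd_swap, h]
  have e : ((p.2 : ℂ) + 1) ^ 2 * (-1 / τ) ^ 2 - ((p.1 : ℂ) + 1) ^ 2 =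
      -(((p.1 : ℂ) + 1) ^ 2 * τ ^ 2 - ((p.2 : ℂ) + 1) ^ 2) / τ ^ 2 := by
    field_simp
    ring
  rw [e]
  generalize ((p.1 : ℂ) + 1) ^ 2 * τ ^ 2 - ((p.2 : ℂ) + 1) ^ 2 = w
  -- Here τ is only nonzero, so w may vanish; both sides are then 0 by the convention 1/0 = 0.
  rcases eq_or_ne w 0 with rfl | hw
  · simp
  · field_simp

/-! ### Cotangent sums and Ramanujan's formula -/

theorem pi_mul_cot_eq_series {z : ℂ} (hz : 0 < z.im) :
    (Real.pi : ℂ) * Complex.cot (Real.pi * z) =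
      1 / z + ∑' m : ℕ, 2 * z * (1 / (z ^ 2 - ((m : ℂ) + 1) ^ 2)) := by
  have hmem : z ∈ Complex.integerComplement := by
    rintro ⟨a, rfl⟩
    simp at hz
  have h := cot_series_rep' hmem
  rw [sub_eq_iff_eq_add'] at h
  rw [h]
  congr 1
  refine tsum_congr fun m => ?_
  have n1 : z - ((m : ℂ) + 1) ≠ 0 := fun h => by
    have := congrArg Complex.im h
    simp at this
    linarith
  have n2 : z + ((m : ℂ) + 1) ≠ 0 := fun h => by
    have := congrArg Complex.im h
    simp at this
    linarith
  rw [sq_sub_sq]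
  field_simp
  ring

theorem pi_mul_cot_eq_exp {z : ℂ} (hz : Complex.exp (2 * Real.pi * Complex.I * z) ≠ 1) :
    (Real.pi : ℂ) * Complex.cot (Real.pi * z) =
      -(Real.pi * Complex.I) * (1 + 2 * (Complex.exp (2 * Real.pi * Complex.I * z) /
        (1 - Complex.exp (2 * Real.pi * Complex.I * z)))) := by
  rw [Complex.cot_pi_eq_exp_ratio]
  generalize Complex.exp (2 * Real.pi * Complex.I * z) = q at *
  have h : 1 - q ≠ 0 := fun h => hz (sub_eq_zero.mp h).symm
  field_simp
  rw [Complex.I_sq]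
  ring

theorem norm_exp_two_pi_I_mul_lt_one (τ : UpperHalfPlane) :
    ‖Complex.exp (2 * Real.pi * Complex.I * (τ : ℂ))‖ < 1 := by
  rw [Complex.norm_exp, Real.exp_lt_one_iff]
  have h := mul_pos Real.two_pi_pos τ.im_pos
  simp [Complex.mul_re]
  linarith

/-- In π cot(πz) = -πi(1 + 2q/(1-q)) the constant 1 produces ζ(M)/2 and the rest the Lambert series.
-/
theorem hasSum_cot_lambertSeries (τ : UpperHalfPlane) {M : ℕ} (hM : 2 ≤ M) :
    HasSum (fun n : ℕ => 1 / ((n : ℂ) + 1) ^ M *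
        (Real.pi * Complex.cot (Real.pi * (((n : ℂ) + 1) * τ))))
      (-(2 * Real.pi * Complex.I) * (riemannZeta M / 2
        + lambertSeries (Complex.exp (2 * Real.pi * Complex.I * (τ : ℂ))) (-(M : ℂ)))) := by
  have hq := norm_exp_two_pi_I_mul_lt_one τ
  have h1 := (summable_one_div_succ_pow hM).hasSum
  rw [← riemannZeta_eq_tsum_succ hM] at h1
  have h2 : HasSum _ (lambertSeries _ _) := (summable_lambertTerm hq M).hasSum
  convert! ((h1.div_const 2).add h2).mul_left (-(2 * Real.pi * Complex.I)) using 2 with n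
  have e : Complex.exp (2 * Real.pi * Complex.I * (((n : ℂ) + 1) * τ)) =
      Complex.exp (2 * Real.pi * Complex.I * (τ : ℂ)) ^ (n + 1) := by
    rw [← Complex.exp_nat_mul]
    congr 1
    push_cast
    ring
  have hn := norm_pow_succ_lt_one hq n
  rw [← e] at hn
  rw [pi_mul_cot_eq_exp (fun h => by rw [h] at hn; simp at hn), lambertTerm_neg_natCast, e,
    ← div_div]
  ring

/-- The pole of cot at 0 contributes the zeta value; the remaining poles, paired as ±m, give the
double series. -/
theorem hasSum_cot_cotDoubleTerm (τ : UpperHalfPlane) {N : ℕ} (hN : 1 ≤ N) :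
    HasSum (fun n : ℕ => 1 / ((n : ℂ) + 1) ^ (2 * N + 1) *
        (Real.pi * Complex.cot (Real.pi * (((n : ℂ) + 1) * τ))))
      (riemannZeta (2 * (N + 1) : ℕ) / τ + 2 * τ * ∑' p, cotDoubleTerm N τ p) := by
  have h1 := (summable_one_div_succ_pow (a := 2 * (N + 1)) (by omega)).hasSum
  rw [← riemannZeta_eq_tsum_succ (by omega)] at h1
  have hs := summable_cotDoubleTerm τ hN
  have h2 := hs.hasSum.prod_fiberwise fun n => (hs.prod_factor n).hasSum
  convert! (h1.div_const (τ : ℂ)).add (h2.mul_left (2 * (τ : ℂ))) using 2 with n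
  have hn : (n : ℂ) + 1 ≠ 0 := Nat.cast_add_one_ne_zero _
  have hτ : (τ : ℂ) ≠ 0 := UpperHalfPlane.ne_zero τ
  have him : 0 < (((n : ℂ) + 1) * (τ : ℂ)).im := by
    have : (((n : ℂ) + 1) * (τ : ℂ)).im = ((n : ℝ) + 1) * (τ : ℂ).im := by simp
    rw [this]
    exact mul_pos (by positivity) τ.im_pos
  rw [pi_mul_cot_eq_series him, mul_add, ← tsum_mul_left, ← tsum_mul_left]
  congr 1
  · field_simp
    ring
  · refine tsum_congr fun m => ?_
    rw [cotDoubleTerm, mul_pow, ← one_div_mul_one_div, pow_succ _ (2 * N)]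
    field_simp

/-- Ramanujan's transformation formula for the Lambert series at negative odd integers. -/
theorem ramanujan_lambertSeries {τ τ' : ℂ} (hτ : 0 < τ.im) (h : τ' = -1 / τ) {N : ℕ}
    (hN : 1 ≤ N) :
    riemannZeta (2 * N + 1 : ℕ) / 2
        + lambertSeries (Complex.exp (2 * Real.pi * Complex.I * τ)) (-((2 * N + 1 : ℕ) : ℂ)) =
      τ ^ (2 * N) * (riemannZeta (2 * N + 1 : ℕ) / 2
        + lambertSeries (Complex.exp (2 * Real.pi * Complex.I * τ')) (-((2 * N + 1 : ℕ) : ℂ)))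
      + 1 / (Real.pi * Complex.I) * ∑ j ∈ Finset.range (N + 2),
          τ ^ (2 * j) / τ * (riemannZeta (2 * j : ℕ) * riemannZeta (2 * (N + 1 - j) : ℕ)) := by
  have hτ0 : τ ≠ 0 := by
    rintro rfl
    simp at hτ
  have hτ' : 0 < τ'.im := by
    rw [h, neg_div, Complex.neg_im, Complex.div_im]
    simp only [Complex.one_im, Complex.one_re, zero_mul, zero_div, one_mul, zero_sub, neg_neg]
    have := Complex.normSq_pos.mpr hτ0
    exact div_pos hτ this
  have a1 := (hasSum_cot_lambertSeries ⟨τ, hτ⟩ (M := 2 * N + 1) (by omega)).unique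
    (hasSum_cot_cotDoubleTerm ⟨τ, hτ⟩ hN)
  have a2 := (hasSum_cot_lambertSeries ⟨τ', hτ'⟩ (M := 2 * N + 1) (by omega)).unique
    (hasSum_cot_cotDoubleTerm ⟨τ', hτ'⟩ hN)
  rw [tsum_cotDoubleTerm_eq _ hN] at a1
  simp only at a1 a2
  rw [tsum_cotDoubleTerm_neg_inv hτ0 h] at a2
  -- The end terms j = 0 and j = N+1 contain ζ(0) = -1/2, so they absorb the isolated ζ(2N+2) terms
  -- of the two cotangent evaluations.
  have hsum : ∑ j ∈ Finset.range (N + 2),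
      τ ^ (2 * j) / τ * (riemannZeta (2 * j : ℕ) * riemannZeta (2 * (N + 1 - j) : ℕ)) =
      τ * ∑ i ∈ Finset.range N, τ ^ (2 * i) *
        (riemannZeta (2 * (N - i) : ℕ) * riemannZeta (2 * (i + 1) : ℕ))
      - riemannZeta (2 * (N + 1) : ℕ) / (2 * τ)
      - τ ^ (2 * N) * τ * riemannZeta (2 * (N + 1) : ℕ) / 2 := by
    rw [Finset.sum_range_succ', Finset.sum_range_succ, Finset.mul_sum]
    have e : ∀ i ∈ Finset.range N, τ ^ (2 * (i + 1)) / τ *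
        (riemannZeta (2 * (i + 1) : ℕ) * riemannZeta (2 * (N + 1 - (i + 1)) : ℕ)) =
        τ * (τ ^ (2 * i) *
        (riemannZeta (2 * (N - i) : ℕ) * riemannZeta (2 * (i + 1) : ℕ))) := by
      intro i _
      rw [show N + 1 - (i + 1) = N - i by omega, mul_add, pow_add]
      field_simp
    rw [Finset.sum_congr rfl e]
    simp only [Nat.sub_self, mul_zero, Nat.cast_zero, riemannZeta_zero, pow_zero, Nat.sub_zero]
    rw [mul_add, pow_add]
    field_simp
    ring
  rw [hsum]
  generalize ∑ i ∈ Finset.range N, τ ^ (2 * i) *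
        (riemannZeta (2 * (N - i) : ℕ) * riemannZeta (2 * (i + 1) : ℕ)) = S at *
  have hπ : (Real.pi : ℂ) ≠ 0 := by exact_mod_cast Real.pi_ne_zero
  rw [h] at a2
  have hinv : -1 / τ = -τ⁻¹ := by ring
  have b2 : riemannZeta (2 * (N + 1) : ℕ) / (-1 / τ) = -(τ * riemannZeta (2 * (N + 1) : ℕ)) := by
    rw [hinv]
    field_simp
  rw [b2] at a2
  have b3 : 2 * (-1 / τ) * (-τ ^ 2 * ∑' p, cotDoubleTermSwap N τ p) =
      2 * τ * ∑' p, cotDoubleTermSwap N τ p := by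
    field_simp
  rw [b3, ← h] at a2
  have hc : -(2 * Real.pi * Complex.I) ≠ 0 := by simp [hπ]
  apply mul_left_cancel₀ hc
  have b4 : -(2 * (Real.pi : ℂ) * Complex.I) * (1 / (Real.pi * Complex.I)) = -2 := by
    field_simp
  rw [mul_add (-(2 * (Real.pi : ℂ) * Complex.I)) (τ ^ (2 * N) * _), ← mul_assoc _ (1 / _), b4]
  linear_combination a1 - τ ^ (2 * N) * a2

/-! ### Trigonometric and Bernoulli coefficients -/

theorem sin_two_mul_sub_one_mul_pi_div_three (j : ℕ) :
    Real.sin ((2 * (j : ℝ) - 1) * Real.pi / 3) =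
      (-1) ^ (j + 1) * Real.cos ((2 * (j : ℝ) - 1) * Real.pi / 6) := by
  rw [show (2 * (j : ℝ) - 1) * Real.pi / 3 =
      -(((2 * (j : ℝ) - 1) * Real.pi / 6 + Real.pi / 2) - j * Real.pi) by ring,
    Real.sin_neg, Real.sin_sub_nat_mul_pi, Real.sin_add_pi_div_two]
  ring

theorem coeffA_eq (k : ℕ) :
    coeffA k = 2 ^ (4 * k) - 4 * Real.cos (((4 * k - 2 : ℝ)) * Real.pi / 3) := by
  rw [coeffA, show (4 * (k : ℝ) + 1) * Real.pi / 6 =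
      Real.pi / 2 - ((4 * k - 2 : ℝ) * Real.pi / 3 - (2 * k : ℕ) * Real.pi + Real.pi) by
        push_cast; ring,
    Real.sin_pi_div_two_sub, Real.cos_add_pi, Real.cos_sub_nat_mul_pi, (even_two_mul k).neg_one_pow]
  ring

theorem cos_two_mul_sub_one_mul_pi_div_three (k : ℕ) :
    Real.cos ((2 * (k : ℝ) - 1) * Real.pi / 3) =
      -Real.cos (((4 * k - 2 : ℝ)) * Real.pi / 3) := by
  rw [show (2 * (k : ℝ) - 1) * Real.pi / 3 =
      -(((4 * k - 2 : ℝ) * Real.pi / 3 - (2 * k : ℕ) * Real.pi + Real.pi)) by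
        push_cast; ring,
    Real.cos_neg, Real.cos_add_pi, Real.cos_sub_nat_mul_pi, (even_two_mul k).neg_one_pow]
  ring

theorem coeffA_pos {k : ℕ} (hk : 1 ≤ k) : 0 < coeffA k := by
  rw [coeffA]
  have h1 : (2 : ℝ) ^ 4 ≤ 2 ^ (4 * k) := pow_le_pow_right₀ one_le_two (by omega)
  have h2 := Real.neg_one_le_sin ((4 * (k : ℝ) + 1) * Real.pi / 6)
  linarith

/-- Pairing j with 2k-j counts the middle index twice; this is the source of the factor 1 + δ_{jk}.
-/
theorem sum_range_fold (f : ℕ → ℝ) (k : ℕ) :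
    ∑ j ∈ Finset.range (2 * k + 1), f j =
      ∑ j ∈ Finset.range (k + 1), (f j + f (2 * k - j)) / (1 + if j = k then 1 else 0) := by
  rw [show 2 * k + 1 = (k + 1) + k by ring, Finset.sum_range_add, Finset.sum_range_succ,
    Finset.sum_range_succ, ← Finset.sum_range_reflect (fun x => f (k + 1 + x))]
  have e : ∀ j ∈ Finset.range k, (f j + f (2 * k - j)) / (1 + if j = k then 1 else 0) =
      f j + f (k + 1 + (k - 1 - j)) := by
    intro j hj
    have hj' := Finset.mem_range.mp hj
    rw [if_neg hj'.ne, show 2 * k - j = k + 1 + (k - 1 - j) by omega]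
    ring
  rw [Finset.sum_congr rfl e, Finset.sum_add_distrib, if_pos rfl, show 2 * k - k = k by omega]
  ring

/-- The symmetric product of two normalised Bernoulli numbers. -/
noncomputable def bernoulliProd (k j : ℕ) : ℝ :=
  (bernoulli (2 * j) : ℝ) * (bernoulli (4 * k - 2 * j) : ℝ)
    / (((2 * j).factorial : ℝ) * ((4 * k - 2 * j).factorial : ℝ))

/-- The Bernoulli product is invariant under j ↔ 2k-j, so the two summands in the numerator of
b_{jk} are the contributions of j and of 2k-j. -/
theorem bernoulliPart_mul_coeffA {k : ℕ} (hk : 1 ≤ k) :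
    bernoulliPart k * coeffA k = (2 * Real.pi) ^ (4 * k - 1) *
      ∑ j ∈ Finset.range (2 * k + 1), (2 : ℝ) ^ (4 * (k : ℤ) + 1 - 2 * (j : ℤ)) *
        Real.sin ((2 * (j : ℝ) - 1) * Real.pi / 3) * bernoulliProd k j := by
  rw [sum_range_fold, bernoulliPart, mul_assoc, Finset.sum_mul]
  congr 1
  refine Finset.sum_congr rfl fun j hj => ?_
  have hj' : j ≤ k := Nat.lt_succ_iff.mp (Finset.mem_range.mp hj)
  have ha := (coeffA_pos hk).ne'
  have hd : (1 + if j = k then 1 else 0 : ℝ) ≠ 0 := by split_ifs <;> norm_num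
  have hB : bernoulliProd k (2 * k - j) = bernoulliProd k j := by
    rw [bernoulliProd, bernoulliProd, show 2 * (2 * k - j) = 4 * k - 2 * j by omega,
      show 4 * k - (4 * k - 2 * j) = 2 * j by omega]
    ring
  have hs : ((-1 : ℝ)) ^ (2 * k - j + 1) = (-1) ^ (j + 1) := by
    have h1 : (-1 : ℝ) ^ (2 * j) = 1 := (even_two_mul j).neg_one_pow
    have h2 : (-1 : ℝ) ^ (2 * k) = 1 := (even_two_mul k).neg_one_pow
    calc (-1 : ℝ) ^ (2 * k - j + 1) = (-1) ^ (2 * k - j + 1) * (-1) ^ (2 * j) := by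
          rw [h1, mul_one]
      _ = (-1) ^ (2 * k) * (-1) ^ (j + 1) := by
          rw [← pow_add, ← pow_add]
          congr 1
          omega
      _ = (-1) ^ (j + 1) := by rw [h2, one_mul]
  have hc : ((2 * k - j : ℕ) : ℝ) = 2 * k - j := by
    rw [Nat.cast_sub (by omega)]
    push_cast
    ring
  have hz : (4 * (k : ℤ) + 1 - 2 * ((2 * k - j : ℕ) : ℤ)) = 2 * (j : ℤ) + 1 := by omega
  rw [sin_two_mul_sub_one_mul_pi_div_three, sin_two_mul_sub_one_mul_pi_div_three, hB, hs, hz, hc,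
    show 2 * (2 * (k : ℝ) - j) - 1 = 4 * k - 1 - 2 * j by ring, coeffB, bernoulliProd]
  field_simp

theorem riemannZeta_mul_riemannZeta_even {k j : ℕ} (hj : j ≤ 2 * k) :
    riemannZeta (2 * j : ℕ) * riemannZeta (2 * (2 * k - j) : ℕ) =
      (2 * Real.pi) ^ (4 * k) / 4 * (bernoulliProd k j : ℂ) := by
  obtain ⟨l, hl⟩ := Nat.exists_eq_add_of_le hj
  have hz : ∀ i : ℕ, riemannZeta (2 * i : ℕ) =
      (-1) ^ (i + 1) * (2 * Real.pi) ^ (2 * i) / 2 * bernoulli (2 * i) / (2 * i).factorial := by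
    intro i
    push_cast
    rw [riemannZeta_two_mul_nat', zpow_sub₀ two_ne_zero, zpow_one, mul_pow]
    norm_cast
    push_cast
    ring
  rw [hz, hz, show 2 * k - j = l by omega, bernoulliProd, show 4 * k - 2 * j = 2 * l by omega,
    show 4 * k = 2 * j + 2 * l by omega, pow_add]
  have hs : (-1 : ℂ) ^ (j + 1) * (-1) ^ (l + 1) = 1 := by
    rw [← pow_add]
    exact Even.neg_one_pow ⟨k + 1, by omega⟩
  push_cast
  linear_combination (2 * (Real.pi : ℂ)) ^ (2 * j) * (2 * Real.pi) ^ (2 * l) / 4 *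
    bernoulli (2 * j) / (2 * j).factorial * (bernoulli (2 * l) / (2 * l).factorial) * hs

/-! ### The points (±1 + i√3)/4 -/

theorem exp_pi_div_three :
    Complex.exp ((Real.pi / 3 : ℝ) * Complex.I) = (1 + Complex.I * (Real.sqrt 3 : ℝ)) / 2 := by
  rw [Complex.exp_mul_I, ← Complex.ofReal_cos, ← Complex.ofReal_sin, Real.cos_pi_div_three,
    Real.sin_pi_div_three]
  push_cast
  ring

theorem exp_neg_pi_div_three :
    Complex.exp (-(Real.pi / 3 : ℝ) * Complex.I) = (1 - Complex.I * (Real.sqrt 3 : ℝ)) / 2 := by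
  rw [Complex.exp_mul_I, Complex.cos_neg, Complex.sin_neg, ← Complex.ofReal_cos,
    ← Complex.ofReal_sin, Real.cos_pi_div_three, Real.sin_pi_div_three]
  push_cast
  ring

/-- The points are ω/2 and -ω̄/2 with ω = e^(iπ/3); an even power loses the sign, leaving twice a
real part. -/
theorem sixth_root_pow_add (n : ℕ) :
    ((1 + Complex.I * (Real.sqrt 3 : ℝ)) / 4) ^ (2 * n)
        + ((-1 + Complex.I * (Real.sqrt 3 : ℝ)) / 4) ^ (2 * n) =
      2 / 2 ^ (2 * n) * (Real.cos (2 * n * Real.pi / 3) : ℂ) := by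
  have e1 : (1 + Complex.I * (Real.sqrt 3 : ℝ)) / 4 =
      Complex.exp ((Real.pi / 3 : ℝ) * Complex.I) / 2 := by
    rw [exp_pi_div_three]
    ring
  have e2 : (-1 + Complex.I * (Real.sqrt 3 : ℝ)) / 4 =
      -(Complex.exp (-(Real.pi / 3 : ℝ) * Complex.I) / 2) := by
    rw [exp_neg_pi_div_three]
    ring
  rw [e1, e2, (even_two_mul n).neg_pow, div_pow, div_pow, ← Complex.exp_nat_mul,
    ← Complex.exp_nat_mul, Complex.ofReal_cos, Complex.cos]
  rw [show ((2 * n : ℕ) : ℂ) * ((Real.pi / 3 : ℝ) * Complex.I) =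
      ((2 * n * Real.pi / 3 : ℝ) : ℂ) * Complex.I by push_cast; ring,
    show ((2 * n : ℕ) : ℂ) * (-(Real.pi / 3 : ℝ) * Complex.I) =
      -((2 * n * Real.pi / 3 : ℝ) : ℂ) * Complex.I by push_cast; ring]
  ring

/-- The total exponent 2j-1 is odd, so the sign survives and the difference of conjugates gives a
sine. -/
theorem sixth_root_pow_div_add (j : ℕ) :
    ((1 + Complex.I * (Real.sqrt 3 : ℝ)) / 4) ^ (2 * j) / ((1 + Complex.I * (Real.sqrt 3 : ℝ)) / 4)
        + ((-1 + Complex.I * (Real.sqrt 3 : ℝ)) / 4) ^ (2 * j)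
          / ((-1 + Complex.I * (Real.sqrt 3 : ℝ)) / 4) =
      4 / 2 ^ (2 * j) * Complex.I * (Real.sin ((2 * (j : ℝ) - 1) * Real.pi / 3) : ℂ) := by
  have e1 : (1 + Complex.I * (Real.sqrt 3 : ℝ)) / 4 =
      Complex.exp ((Real.pi / 3 : ℝ) * Complex.I) / 2 := by
    rw [exp_pi_div_three]
    ring
  have e2 : (-1 + Complex.I * (Real.sqrt 3 : ℝ)) / 4 =
      -(Complex.exp (-(Real.pi / 3 : ℝ) * Complex.I) / 2) := by
    rw [exp_neg_pi_div_three]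
    ring
  rw [e1, e2, (even_two_mul j).neg_pow, div_pow, div_pow, Complex.ofReal_sin, Complex.sin]
  rw [show ((((2 * (j : ℝ) - 1) * Real.pi / 3 : ℝ)) : ℂ) * Complex.I =
      ((2 * j : ℕ) : ℂ) * ((Real.pi / 3 : ℝ) * Complex.I) - (Real.pi / 3 : ℝ) * Complex.I by
        push_cast; ring,
    show -((((2 * (j : ℝ) - 1) * Real.pi / 3 : ℝ)) : ℂ) * Complex.I =
      ((2 * j : ℕ) : ℂ) * (-(Real.pi / 3 : ℝ) * Complex.I) - -(Real.pi / 3 : ℝ) * Complex.I by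
        push_cast; ring, Complex.exp_sub, Complex.exp_sub, Complex.exp_nat_mul,
    Complex.exp_nat_mul]
  have n1 := Complex.exp_ne_zero ((Real.pi / 3 : ℝ) * Complex.I)
  have n2 := Complex.exp_ne_zero (-(Real.pi / 3 : ℝ) * Complex.I)
  generalize Complex.exp ((Real.pi / 3 : ℝ) * Complex.I) = x at *
  generalize Complex.exp (-(Real.pi / 3 : ℝ) * Complex.I) = y at *
  field_simp
  rw [Complex.I_sq]
  ring

theorem norm_nome_lt_one {m : ℕ} (hm : 0 < m) : ‖nome m‖ < 1 := by
  rw [nome, Complex.norm_real, Real.norm_eq_abs, Real.abs_exp, Real.exp_lt_one_iff]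
  have : (0 : ℝ) < m := by exact_mod_cast hm
  have := Real.pi_pos
  have : (0 : ℝ) < Real.sqrt 3 := by positivity
  exact neg_neg_of_pos (by positivity)

theorem nome_one_pow (m : ℕ) : nome 1 ^ m = nome m := by
  rw [nome, nome, ← Complex.ofReal_pow, ← Real.exp_nat_mul]
  congr 2
  push_cast
  ring

theorem exp_eq_nome (m : ℕ) {τ : ℂ} (n : ℤ)
    (h : 2 * τ = 2 * n + Complex.I * (m * (Real.sqrt 3 : ℝ))) :
    Complex.exp (2 * Real.pi * Complex.I * τ) = nome m := by
  rw [nome, Complex.ofReal_exp, Complex.exp_eq_exp_iff_exists_int]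
  refine ⟨n, ?_⟩
  push_cast
  linear_combination (Real.pi * Complex.I) * h + m * Real.pi * (Real.sqrt 3 : ℝ) * Complex.I_sq

/-- The transformation formula summed over the two points `(±1 + i√3) / 4`. -/
theorem lambertSeries_sixth_root {k : ℕ} (hk : 1 ≤ k) {r : ℂ}
    (hr : r = Complex.exp (2 * Real.pi * Complex.I * ((1 + Complex.I * (Real.sqrt 3 : ℝ)) / 4))) :
    riemannZeta (4 * k - 1 : ℕ) + (lambertSeries r (-((4 * k - 1 : ℕ) : ℂ))
        + lambertSeries (-r) (-((4 * k - 1 : ℕ) : ℂ))) =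
      8 / 2 ^ (4 * k) * (Real.cos ((4 * k - 2 : ℝ) * Real.pi / 3) : ℂ) *
        (riemannZeta (4 * k - 1 : ℕ) / 2 + lambertSeries (nome 2) (-((4 * k - 1 : ℕ) : ℂ)))
      + ((bernoulliPart k * coeffA k : ℝ) : ℂ) / 2 ^ (4 * k) := by
  obtain ⟨N, rfl⟩ : ∃ N, k = N + 1 := ⟨k - 1, by omega⟩
  have h3 : ((Real.sqrt 3 : ℝ) : ℂ) ^ 2 = 3 := by
    rw [← Complex.ofReal_pow, Real.sq_sqrt (by norm_num)]
    norm_num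
  have hprod : (1 + Complex.I * (Real.sqrt 3 : ℝ)) * (-1 + Complex.I * (Real.sqrt 3 : ℝ)) = -4 := by
    linear_combination (Real.sqrt 3 : ℂ) ^ 2 * Complex.I_sq - h3
  have n1 : (1 + Complex.I * (Real.sqrt 3 : ℝ)) ≠ 0 := fun h => by simp [h] at hprod
  have n2 : (-1 + Complex.I * (Real.sqrt 3 : ℝ)) ≠ 0 := fun h => by simp [h] at hprod
  -- Since k = N+1 here, the parameter 2N+1 = 2k-1 gives the exponent 2(2N+1)+1 = 4k-1.
  have R1 := ramanujan_lambertSeries (τ := (1 + Complex.I * (Real.sqrt 3 : ℝ)) / 4)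
    (τ' := -1 + Complex.I * (Real.sqrt 3 : ℝ)) (by simp) (by field_simp; linear_combination hprod)
    (N := 2 * N + 1) (by omega)
  have R2 := ramanujan_lambertSeries (τ := (-1 + Complex.I * (Real.sqrt 3 : ℝ)) / 4)
    (τ' := 1 + Complex.I * (Real.sqrt 3 : ℝ)) (by simp) (by field_simp; linear_combination hprod)
    (N := 2 * N + 1) (by omega)
  rw [exp_eq_nome 2 (τ := -1 + Complex.I * (Real.sqrt 3 : ℝ)) (-1) (by push_cast; ring), ← hr] at R1
  have hr' : Complex.exp (2 * Real.pi * Complex.I *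
      ((-1 + Complex.I * (Real.sqrt 3 : ℝ)) / 4)) = -r := by
    rw [hr, ← Complex.exp_sub_pi_mul_I]
    congr 1
    ring
  rw [exp_eq_nome 2 (τ := 1 + Complex.I * (Real.sqrt 3 : ℝ)) 1 (by push_cast; ring), hr'] at R2
  have hπ : (Real.pi : ℂ) ≠ 0 := by exact_mod_cast Real.pi_ne_zero
  have hP := sixth_root_pow_add (2 * N + 1)
  have hB : 1 / (Real.pi * Complex.I) * ∑ j ∈ Finset.range (2 * N + 1 + 2),
      ((1 + Complex.I * (Real.sqrt 3 : ℝ)) / 4) ^ (2 * j)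
          / ((1 + Complex.I * (Real.sqrt 3 : ℝ)) / 4)
          * (riemannZeta (2 * j : ℕ) * riemannZeta (2 * (2 * N + 1 + 1 - j) : ℕ))
      + 1 / (Real.pi * Complex.I) * ∑ j ∈ Finset.range (2 * N + 1 + 2),
      ((-1 + Complex.I * (Real.sqrt 3 : ℝ)) / 4) ^ (2 * j)
          / ((-1 + Complex.I * (Real.sqrt 3 : ℝ)) / 4)
          * (riemannZeta (2 * j : ℕ) * riemannZeta (2 * (2 * N + 1 + 1 - j) : ℕ)) =
      ((bernoulliPart (N + 1) * coeffA (N + 1) : ℝ) : ℂ) / 2 ^ (4 * (N + 1)) := by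
    rw [bernoulliPart_mul_coeffA hk, ← mul_add, ← Finset.sum_add_distrib, Finset.mul_sum,
      Complex.ofReal_mul, Complex.ofReal_sum, Finset.mul_sum, Finset.sum_div]
    refine Finset.sum_congr (by congr 1) fun j hj => ?_
    have hj' : j ≤ 2 * (N + 1) := by
      have := Finset.mem_range.mp hj
      omega
    rw [← add_mul, sixth_root_pow_div_add, show 2 * N + 1 + 1 - j = 2 * (N + 1) - j by omega,
      riemannZeta_mul_riemannZeta_even hj', show 4 * (N + 1) - 1 = 4 * N + 3 by omega,
      show 4 * (N + 1) = 4 * N + 3 + 1 by ring, pow_succ _ (4 * N + 3)]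
    have hz : (2 : ℝ) ^ (4 * ((N + 1 : ℕ) : ℤ) + 1 - 2 * (j : ℤ)) =
        2 ^ (4 * N + 3 + 1) * 2 / 2 ^ (2 * j) := by
      rw [zpow_sub₀ two_ne_zero, zpow_add₀ two_ne_zero]
      norm_cast
    rw [hz]
    push_cast
    field_simp
  have hpow : (2 : ℂ) ^ (4 * (N + 1)) = 4 * 2 ^ (2 * (2 * N + 1)) := by ring
  have hcos : (Real.cos (2 * ((2 * N + 1 : ℕ) : ℝ) * Real.pi / 3)) =
      Real.cos ((4 * ((N + 1 : ℕ) : ℝ) - 2) * Real.pi / 3) := by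
    congr 1
    push_cast
    ring
  rw [hcos] at hP
  have hM : 4 * (N + 1) - 1 = 2 * (2 * N + 1) + 1 := by omega
  have hc : (8 : ℂ) / 2 ^ (4 * (N + 1)) = 2 / 2 ^ (2 * (2 * N + 1)) := by
    rw [hpow]
    field_simp
    norm_num
  rw [hc, ← hP, ← hB, hM]
  linear_combination R1 + R2

/-! ### Elimination of the auxiliary nomes -/

theorem riemannZeta_mul_coeffA {k : ℕ} (hk : 1 ≤ k) :
    riemannZeta (4 * k - 1 : ℕ) * coeffA k = ((bernoulliPart k * coeffA k : ℝ) : ℂ)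
      + (2 * 2 ^ (4 * k) + 4) * lambertSeries (nome 1) (-((4 * k - 1 : ℕ) : ℂ))
      - (4 * 2 ^ (4 * k) + 16 / 2 ^ (4 * k) + 12
          - 8 * (Real.cos ((4 * k - 2 : ℝ) * Real.pi / 3) : ℂ))
        * lambertSeries (nome 2) (-((4 * k - 1 : ℕ) : ℂ))
      + (16 / 2 ^ (4 * k) + 8) * lambertSeries (nome 4) (-((4 * k - 1 : ℕ) : ℂ)) := by
  obtain ⟨r, hr⟩ : ∃ r, r = Complex.exp
    (2 * Real.pi * Complex.I * ((1 + Complex.I * (Real.sqrt 3 : ℝ)) / 4)) := ⟨_, rfl⟩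
  have hT := lambertSeries_sixth_root hk hr
  have hr1 : ‖r‖ < 1 := by
    have him : 0 < ((1 + Complex.I * (Real.sqrt 3 : ℝ)) / 4 : ℂ).im := by simp
    rw [hr]
    exact norm_exp_two_pi_I_mul_lt_one ⟨_, him⟩
  have hr2 : r ^ 2 = -nome 1 := by
    -- The real part of 2τ is 1/2; removing it leaves a purely imaginary point of nome e^(-√3π) and
    -- accounts for the sign in r² = -e^(-√3π).
    have h : (2 : ℂ) * (((1 + Complex.I * (Real.sqrt 3 : ℝ)) / 4) * 2 - 1 / 2) =
        2 * (0 : ℤ) + Complex.I * ((1 : ℕ) * (Real.sqrt 3 : ℝ)) := by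
      push_cast
      ring
    rw [← exp_eq_nome 1 0 h, hr, ← Complex.exp_nat_mul, ← Complex.exp_sub_pi_mul_I,
      Complex.exp_eq_exp_iff_exists_int]
    refine ⟨1, ?_⟩
    push_cast
    ring
  have hr4 : r ^ 4 = nome 2 := by
    rw [← nome_one_pow 2, ← neg_sq, ← hr2, ← pow_mul]
  have hA := lambertSeries_add_neg hr1 (4 * k - 1)
  have hB := lambertSeries_add_neg (norm_nome_lt_one one_pos) (4 * k - 1)
  rw [hr2, hr4] at hA
  rw [nome_one_pow, nome_one_pow] at hB
  have hpow : (2 : ℂ) / 2 ^ (4 * k - 1) = 4 / 2 ^ (4 * k) := by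
    obtain ⟨N, rfl⟩ : ∃ N, k = N + 1 := ⟨k - 1, by omega⟩
    rw [show 4 * (N + 1) = 4 * (N + 1) - 1 + 1 by omega, pow_succ, Nat.add_sub_cancel]
    field_simp
    norm_num
  rw [hpow] at hA hB
  have ha : (coeffA k : ℂ) = 2 ^ (4 * k) - 4 * (Real.cos ((4 * k - 2 : ℝ) * Real.pi / 3) : ℂ) := by
    rw [coeffA_eq]
    push_cast
    ring
  have hp : (2 : ℂ) ^ (4 * k) ≠ 0 := pow_ne_zero _ two_ne_zero
  generalize ((bernoulliPart k * coeffA k : ℝ) : ℂ) = b at *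
  rw [ha]
  generalize (Real.cos ((4 * k - 2 : ℝ) * Real.pi / 3) : ℂ) = c at *
  rw [hA] at hT
  generalize (2 : ℂ) ^ (4 * k) = p at *
  -- The parity relation at r = e^(-√3π) eliminates the negative nome.
  have hB' : lambertSeries (-nome 1) (-((4 * k - 1 : ℕ) : ℂ)) =
      (2 + 4 / p) * lambertSeries (nome 2) (-((4 * k - 1 : ℕ) : ℂ))
        - 4 / p * lambertSeries (nome 4) (-((4 * k - 1 : ℕ) : ℂ))
        - lambertSeries (nome 1) (-((4 * k - 1 : ℕ) : ℂ)) := by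
    linear_combination hB
  rw [hB'] at hT
  field_simp at hT ⊢
  linear_combination hT / 2

theorem mainTheorem8 (k : ℕ) (hk : 1 ≤ k) :
    (∀ m ∈ ({1, 2, 4} : Finset ℕ), Summable (lambertTerm (nome m) (-4 * (k : ℂ) + 1))) ∧
    riemannZeta (4 * (k : ℂ) - 1) =
      (bernoulliPart k : ℂ)
      + (((2 : ℝ) ^ (4 * k + 1) + 4) / coeffA k : ℝ)
          * lambertSeries (nome 1) (-4 * (k : ℂ) + 1)
      - (((2 : ℝ) ^ (4 * k + 2) + (2 : ℝ) ^ (-4 * (k : ℤ) + 4) + 12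
            + 8 * Real.cos ((2 * (k : ℝ) - 1) * Real.pi / 3)) / coeffA k : ℝ)
          * lambertSeries (nome 2) (-4 * (k : ℂ) + 1)
      + (((2 : ℝ) ^ (-4 * (k : ℤ) + 4) + 8) / coeffA k : ℝ)
          * lambertSeries (nome 4) (-4 * (k : ℂ) + 1) := by
  have hs : -4 * (k : ℂ) + 1 = -((4 * k - 1 : ℕ) : ℂ) := by
    rw [Nat.cast_sub (by omega)]
    push_cast
    ring
  have hz : 4 * (k : ℂ) - 1 = ((4 * k - 1 : ℕ) : ℂ) := by
    rw [Nat.cast_sub (by omega)]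
    push_cast
    ring
  refine ⟨fun m hm => ?_, ?_⟩
  · rw [hs]
    refine summable_lambertTerm (norm_nome_lt_one ?_) _
    simp only [Finset.mem_insert, Finset.mem_singleton] at hm
    omega
  · have h := riemannZeta_mul_coeffA hk
    have ha : (coeffA k : ℂ) ≠ 0 := by exact_mod_cast (coeffA_pos hk).ne'
    have hp : (2 : ℝ) ^ (-4 * (k : ℤ) + 4) = 16 / 2 ^ (4 * k) := by
      rw [zpow_add₀ two_ne_zero, neg_mul, zpow_neg]
      norm_cast
      rw [inv_mul_eq_div]
      norm_num
    rw [hs, hz, cos_two_mul_sub_one_mul_pi_div_three, hp]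
    apply mul_right_cancel₀ ha
    rw [h, pow_succ _ (4 * k), pow_add _ (4 * k)]
    push_cast
    field_simp
    ring
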